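/- Let $f=(f_1,\dots,f_k)$ be any finite system of polynomials in $\mathbb{R}[x]=\mathbb{R}[x_1,\dots,x_n]$, and let $\mathcal{J}=(\partial f_i/\partial x_j)_{1\le i\le k,\,1\le j\le n}$ be its Jacobian matrix. Let $\mathfrak{a}=(\mathfrak{a}_1,\dots,\mathfrak{a}_n)$ and $\beta$ be further indeterminates. In $\mathbb{R}[x,\mathfrak{a},\beta]$ put $F=(F_1,\dots,F_n)=x-\mathfrak{a}+\beta\cdot\mathcal{J}^{t}\cdot f$, that is, $$F_i = x_i-\mathfrak{a}_i+\beta\sum_{l=1}^{k}\frac{\partial f_l}{\partial x_i}\,f_l\qquad(1\le i\le n),$$ and let $G=\{F_1,\dots,F_n,\ \det(\partial F/\partial x)\}\subset\mathbb{R}[x,\mathfrak{a},\beta]$, where $\partial F/\partial x=(\partial F_i/\partial x_j)_{1\le i,j\le n}$. Then the ideal $\langle G\rangle$ of $\mathbb{R}[x,\mathfrak{a},\beta]$ contains a nonzero polynomial $\phi(\mathfrak{a},\beta)\in\mathbb{R}[\mathfrak{a},\beta]$ in the parameters alone; that is, $\langle G\rangle\cap\mathbb{R}[\mathfrak{a},\beta]\neq\{0\}$.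 -/

import Mathlib

namespace PenaltySystem

/-- The variables of `ℝ[x, 𝔞, β]`, where `x = (x₁, …, xₙ)` are the unknowns and
`𝔞 = (𝔞₁, …, 𝔞ₙ)`, `β` are the parameters. The right summand `Fin n ⊕ Unit` indexes the variables
of the parameter ring `ℝ[𝔞, β]`. -/
abbrev Var (n : ℕ) : Type := Fin n ⊕ (Fin n ⊕ Unit)

/-- The variable `xᵢ` -/
abbrev xVar {n : ℕ} (i : Fin n) : Var n := Sum.inl i

/-- The parameter `𝔞ᵢ` -/
abbrev aVar {n : ℕ} (i : Fin n) : Var n := Sum.inr (Sum.inl i)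

/-- The parameter `β` -/
abbrev betaVar (n : ℕ) : Var n := Sum.inr (Sum.inr ())

/-- The inclusion `ℝ[x] → ℝ[x, 𝔞, β]` -/
noncomputable def ofX (n : ℕ) : MvPolynomial (Fin n) ℝ →ₐ[ℝ] MvPolynomial (Var n) ℝ :=
  MvPolynomial.rename Sum.inl

/-- The inclusion `ℝ[𝔞, β] → ℝ[x, 𝔞, β]` -/
noncomputable def ofParam (n : ℕ) :
    MvPolynomial (Fin n ⊕ Unit) ℝ →ₐ[ℝ] MvPolynomial (Var n) ℝ :=
  MvPolynomial.rename Sum.inr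

/-- The Jacobian matrix `𝒥 = (∂fᵢ/∂xⱼ)` of `f = (f₁, …, fₖ)`, of size `k × n`. -/
noncomputable def jacobian {n k : ℕ} (f : Fin k → MvPolynomial (Fin n) ℝ) :
    Matrix (Fin k) (Fin n) (MvPolynomial (Fin n) ℝ) :=
  Matrix.of fun i j => MvPolynomial.pderiv j (f i)

/-- The system `F = x - 𝔞 + β · 𝒥ᵗ · f` of `n` polynomials in `ℝ[x, 𝔞, β]`. -/
noncomputable def sysF {n k : ℕ} (f : Fin k → MvPolynomial (Fin n) ℝ) (i : Fin n) :
    MvPolynomial (Var n) ℝ :=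
  MvPolynomial.X (xVar i) - MvPolynomial.X (aVar i)
    + MvPolynomial.X (betaVar n) * ofX n (((jacobian f).transpose.mulVec f) i)

/-- The `n × n` matrix `∂F/∂x`. -/
noncomputable def dFdx {n k : ℕ} (f : Fin k → MvPolynomial (Fin n) ℝ) :
    Matrix (Fin n) (Fin n) (MvPolynomial (Var n) ℝ) :=
  Matrix.of fun i j => MvPolynomial.pderiv (xVar j) (sysF f i)

/-- The set `G = {F₁, …, Fₙ, det (∂F/∂x)}`. -/
noncomputable def sysG {n k : ℕ} (f : Fin k → MvPolynomial (Fin n) ℝ) :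
    Set (MvPolynomial (Var n) ℝ) :=
  Set.range (sysF f) ∪ {(dFdx f).det}

end PenaltySystem

namespace PenaltySystem

open MvPolynomial

/-! Modulo the `Fᵢ`, each `𝔞ᵢ` can be eliminated, leaving `ℝ[x, β]`, where the determinant becomes
some `D ≠ 0`. The parameter ring maps to `ℝ[x, β]`, also a polynomial ring in `n + 1` variables. If
this map has a kernel, any nonzero kernel element serves as `φ`. Otherwise `ℝ[x, β]` is algebraic
over the image, so `D` divides a nonzero image element (`exists_ne_zero_dvd_map`). -/

/-- For an endomorphism `θ` of a polynomial ring in finitely many variables over a field, every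
nonzero polynomial divides `θ r` for some `r ≠ 0`. -/
theorem exists_ne_zero_dvd_map {K σ : Type*} [Field K] [Finite σ]
    (θ : MvPolynomial σ K →ₐ[K] MvPolynomial σ K) {D : MvPolynomial σ K} (hD : D ≠ 0) :
    ∃ r, r ≠ 0 ∧ D ∣ θ r := by
  by_cases hθ : Function.Injective θ
  · have hθ' : aeval (fun i => θ (X i)) = θ := algHom_ext fun i => by simp
    have hind : AlgebraicIndependent K fun i => θ (X i) := by
      rw [AlgebraicIndependent, hθ']
      exact hθ
    -- Independent elements, as many as the transcendence degree, form a transcendence basis.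
    have hbasis : IsTranscendenceBasis K fun i => θ (X i) :=
      hind.isTranscendenceBasis_of_lift_trdeg_le_of_finite (by
        rw [MvPolynomial.trdeg_of_isDomain, Cardinal.lift_lift, Cardinal.lift_umax])
    have halg := hbasis.isAlgebraic
    -- An algebraic relation for `D` with nonzero constant term makes `D` divide that term.
    obtain ⟨⟨r, hr⟩, hr0, hdvd⟩ :=
      (halg.isAlgebraic D).exists_nonzero_dvd (mem_nonZeroDivisors_of_ne_zero hD)
    rw [Algebra.adjoin_range_eq_range_aeval, hθ'] at hr
    obtain ⟨s, rfl⟩ := hr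
    refine ⟨s, ?_, hdvd⟩
    rintro rfl
    exact hr0 (Subtype.ext (map_zero θ))
  · rw [injective_iff_map_eq_zero] at hθ
    push Not at hθ
    obtain ⟨r, hr, hr0⟩ := hθ
    exact ⟨r, hr0, hr ▸ dvd_zero D⟩

variable {n k : ℕ} (f : Fin k → MvPolynomial (Fin n) ℝ)

/-- The substitution `𝔞 = x + β · 𝒥ᵗ · f`, as a map `ℝ[x, 𝔞, β] → ℝ[x, β]`. -/
noncomputable def substA : MvPolynomial (Var n) ℝ →ₐ[ℝ] MvPolynomial (Fin n ⊕ Unit) ℝ :=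
  aeval (Sum.elim (fun i => X (Sum.inl i)) (Sum.elim
    (fun i => X (Sum.inl i) + X (Sum.inr ()) *
      rename Sum.inl (((jacobian f).transpose.mulVec f) i))
    (fun _ => X (Sum.inr ()))))

/-- The inclusion `ℝ[x, β] → ℝ[x, 𝔞, β]` -/
noncomputable def ofXBeta (n : ℕ) :
    MvPolynomial (Fin n ⊕ Unit) ℝ →ₐ[ℝ] MvPolynomial (Var n) ℝ :=
  rename (Sum.map id Sum.inr)

theorem ofXBeta_rename_inl (p : MvPolynomial (Fin n) ℝ) :
    ofXBeta n (rename Sum.inl p) = ofX n p := by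
  rw [ofXBeta, ofX, rename_rename]
  rfl

/-- Both sides are algebra maps to the quotient, so only variables need checking; at `𝔞ᵢ` the
difference is `-Fᵢ`. -/
theorem sub_ofXBeta_substA_mem (p : MvPolynomial (Var n) ℝ) :
    p - ofXBeta n (substA f p) ∈ Ideal.span (sysG f) := by
  have h : Ideal.Quotient.mkₐ ℝ (Ideal.span (sysG f)) =
      (Ideal.Quotient.mkₐ ℝ (Ideal.span (sysG f))).comp ((ofXBeta n).comp (substA f)) := by
    refine algHom_ext fun v => Ideal.Quotient.eq.2 ?_
    rcases v with i | i | _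
    · simp [substA, ofXBeta]
    · have hF : -sysF f i ∈ Ideal.span (sysG f) :=
        neg_mem (Ideal.subset_span (Or.inl ⟨i, rfl⟩))
      convert hF using 1
      simp only [AlgHom.comp_apply, substA, aeval_X, Sum.elim_inr, Sum.elim_inl, map_add, map_mul,
        ofXBeta_rename_inl, sysF, RingHom.coe_coe]
      simp only [ofXBeta, rename_X, Sum.map_inl, Sum.map_inr, id]
      ring
    · simp [substA, ofXBeta]
  exact Ideal.Quotient.eq.1 (DFunLike.congr_fun h p)

theorem constantCoeff_substA (p : MvPolynomial (Var n) ℝ) :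
    constantCoeff (substA f p) = constantCoeff p := by
  have h : (constantCoeff : MvPolynomial (Fin n ⊕ Unit) ℝ →+* ℝ).comp (substA f).toRingHom =
      constantCoeff := by
    refine ringHom_ext (fun r => by simp) fun v => ?_
    rcases v with i | i | _ <;> simp [substA]
  exact DFunLike.congr_fun h p

/-- `∂F/∂x` is the identity plus a multiple of `β`, which vanishes at the origin. -/
theorem constantCoeff_det_dFdx : constantCoeff (dFdx f).det = 1 := by
  have h : (constantCoeff : MvPolynomial (Var n) ℝ →+* ℝ).mapMatrix (dFdx f) = 1 := by
    ext i j
    simp [dFdx, sysF, pderiv_X, Matrix.one_apply, Pi.single_apply, apply_ite constantCoeff]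
  rw [RingHom.map_det, h, Matrix.det_one]

end PenaltySystem

theorem mainTheorem5 (n k : ℕ) (f : Fin k → MvPolynomial (Fin n) ℝ) :
    ∃ φ : MvPolynomial (Fin n ⊕ Unit) ℝ,
      φ ≠ 0 ∧ PenaltySystem.ofParam n φ ∈ Ideal.span (PenaltySystem.sysG f) := by
  open PenaltySystem in
  have hD : substA f (dFdx f).det ≠ 0 := fun h => by
    have h1 := constantCoeff_substA f (dFdx f).det
    rw [h, constantCoeff_det_dFdx, map_zero] at h1
    exact zero_ne_one h1
  obtain ⟨φ, hφ, s, hs⟩ := exists_ne_zero_dvd_map ((substA f).comp (ofParam n)) hD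
  refine ⟨φ, hφ, ?_⟩
  have h1 := sub_ofXBeta_substA_mem f (ofParam n φ)
  have h2 := sub_ofXBeta_substA_mem f (dFdx f).det
  have h3 : (dFdx f).det ∈ Ideal.span (sysG f) := Ideal.subset_span (Or.inr rfl)
  rw [AlgHom.comp_apply] at hs
  -- `φ` is congruent to a multiple of the lift of `D`, itself congruent to the determinant.
  rw [hs, map_mul] at h1
  have h4 := (Submodule.sub_mem_iff_right _ h3).1 h2
  exact (Submodule.sub_mem_iff_left _ (Ideal.mul_mem_right _ _ h4)).1 h1
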